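/- Let $n\ge 1$, let $A=(a_{ij})_{i,j=1}^n$ be a real matrix with $a_{ij}\ge 0$ for all $i,j$, let $b=(b_1,\dots,b_n)\in\mathbb R^n$, and assume $$\Bigl(\sum_{j=1}^n\min_{1\le i\le n}|a_{ij}|\Bigr)^2+4\min_{1\le i\le n}b_i>0 .$$ Put $Q(x)=(x_1^2,\dots,x_n^2)$ and $P(x)=Q(x)-Ax-b$, so that $P(x)=0$ is the system $$x_k^2=\sum_{i=1}^n a_{ki}x_i+b_k,\qquad k=1,\dots,n .$$ Let $K'_Q$ be the set of linear functionals $f:\mathbb R^n\to\mathbb R$ for which there is $r>0$ with $f(Q(x))\ge r\|x\|_2^2$ for all $x\in\mathbb R^n$, and let $$\mathcal E_n(Q,A,b)=\bigcap_{f\in K'_Q}\{x\in\mathbb R^n: f(P(x))\le 0\}.$$ Let $M=\max_i\sum_{j=1}^n a_{ij}$, $\bar b=\max_i b_i$ and $\alpha>\tfrac12\bigl(M+\sqrt{M^2+4\bar b}\bigr)$. Then: (a) For every $i$ the maximum $x_i^*=\max\{x_i: x\in\mathcal E_n(Q,A,b)\}$ exists, and $x^*=(x_1^*,\dots,x_n^*)$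 is a solution of the system. (b) The solution $x^*$ is stable: for every $\varepsilon>0$ there is $\delta>0$ such that for every quadratic operator $\tilde Q:\mathbb R^n\to\mathbb R^n$, linear operator $\tilde L:\mathbb R^n\to\mathbb R^n$ and $\tilde c\in\mathbb R^n$ with $\sup_{\|x\|_2\le 1}\|\tilde Q(x)-Q(x)\|_2<\delta$, $\|\tilde L+A\|<\delta$ (operator norm) and $\|\tilde c+b\|_2<\delta$, the equation $\tilde Q(x)+\tilde Lx+\tilde c=0$ has a solution $\tilde x$ with $\|\tilde x-x^*\|_2<\varepsilon$. (c) The Newton–Kantorovich iteration $$x^{(0)}=(\alpha,\dots,\alpha),\qquad x^{(m+1)}=x^{(m)}-[P'(x^{(m)})]^{-1}P(x^{(m)}),\quad m=0,1,2,\dots,$$ is well defined, i.e. $P'(x^{(m)})$ is invertible for every $m$, and $x^{(m)}\to x^*$ as $m\to\infty$. -/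

import Mathlib

open Filter Topology

noncomputable section

namespace EllipticQuadratic

/-- `ℝⁿ` with the Euclidean norm. -/
abbrev Vec (n : ℕ) : Type := EuclideanSpace ℝ (Fin n)

/-- A quadratic operator `ℝⁿ → ℝⁿ`, i.e. `x ↦ B(x, x)` for a bilinear `B`. -/
abbrev QuadOp (n : ℕ) : Type := QuadraticMap ℝ (Vec n) (Vec n)

variable {n : ℕ}

/-- The norm of a quadratic operator, `‖Q‖ = sup {‖Q(x)‖ : ‖x‖ ≤ 1}`. -/
def quadNorm (Q : QuadOp n) : ℝ :=
  sSup ((fun x : Vec n => ‖Q x‖) '' Metric.closedBall 0 1)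

/-- The mapping `P(x) = Q(x) + L x + c`. -/
def opMap (Q : QuadOp n) (L : Vec n →L[ℝ] Vec n) (c : Vec n) : Vec n → Vec n :=
  fun x => Q x + L x + c

/-- The cone `K'_Q` of the linear functionals `f` for which `f(Q(x))` is positive definite. -/
def posCone (Q : QuadOp n) : Set (Vec n →L[ℝ] ℝ) :=
  {f | ∃ r : ℝ, 0 < r ∧ ∀ x : Vec n, r * ‖x‖ ^ 2 ≤ f (Q x)}

/-- The ellipsoid `{x : f(Q(x) + L x + c) ≤ 0}` of a functional `f`. -/
def ellipsoid (Q : QuadOp n) (L : Vec n →L[ℝ] Vec n) (c : Vec n)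
    (f : Vec n →L[ℝ] ℝ) : Set (Vec n) :=
  {x | f (opMap Q L c x) ≤ 0}

/-- The intersection of the ellipsoids of all `f ∈ K'_Q`. -/
def ellipsoidInter (Q : QuadOp n) (L : Vec n →L[ℝ] Vec n) (c : Vec n) : Set (Vec n) :=
  ⋂ f ∈ posCone Q, ellipsoid Q L c f

/-- `x₀` solves `Q(x) + L x + c = 0`, and every equation with nearby data has a solution
near `x₀`. -/
def IsStableSolution (Q : QuadOp n) (L : Vec n →L[ℝ] Vec n) (c : Vec n) (x₀ : Vec n) : Prop :=
  opMap Q L c x₀ = 0 ∧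
    ∀ ε : ℝ, 0 < ε → ∃ δ : ℝ, 0 < δ ∧
      ∀ (Q' : QuadOp n) (L' : Vec n →L[ℝ] Vec n) (c' : Vec n),
        quadNorm (Q' - Q) < δ → ‖L' - L‖ < δ → ‖c' - c‖ < δ →
          ∃ x : Vec n, opMap Q' L' c' x = 0 ∧ ‖x - x₀‖ < ε

/-- The Newton–Kantorovich iteration `x_{m+1} = x_m - [P'(x_m)]⁻¹ P(x_m)`.
(`ContinuousLinearMap.inverse` is the inverse whenever `P'(x_m)` is invertible.) -/
def newtonIter (P : Vec n → Vec n) (x₀ : Vec n) : ℕ → Vec n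
  | 0 => x₀
  | m + 1 => newtonIter P x₀ m -
      (fderiv ℝ P (newtonIter P x₀ m)).inverse (P (newtonIter P x₀ m))

/-- The rank 1 quadratic operator `Q(x) = (x₁², …, xₙ²)`. -/
def sqOp (n : ℕ) : QuadOp n :=
  LinearMap.BilinMap.toQuadraticMap
    (LinearMap.mk₂ ℝ (fun x y : Vec n => (WithLp.toLp 2 fun k => x k * y k : Vec n))
      (by intro x x' y; ext k; simp [add_mul])
      (by intro r x y; ext k; simp [mul_assoc])
      (by intro x y y'; ext k; simp [mul_add])
      (by intro r x y; ext k; simp [mul_left_comm]))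

theorem sqOp_apply (x : Vec n) (k : Fin n) : sqOp n x k = x k ^ 2 := by
  simp [sqOp, sq]

/-- The linear operator `x ↦ A x`. -/
def linOp (A : Matrix (Fin n) (Fin n) ℝ) : Vec n →L[ℝ] Vec n :=
  Matrix.toEuclideanCLM (𝕜 := ℝ) A

theorem linOp_apply (A : Matrix (Fin n) (Fin n) ℝ) (x : Vec n) (k : Fin n) :
    linOp A x k = ∑ i, A k i * x i := by
  simp [linOp, Matrix.ofLp_toEuclideanCLM, Matrix.mulVec, dotProduct]

/-- `P(x) = Q(x) - A x - b` with `Q(x) = (x₁², …, xₙ²)`: the equation `P(x) = 0` is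
`x_k² = ∑ i, a_{ki} x_i + b_k`, `k = 1, …, n`. -/
def rankOneMap (A : Matrix (Fin n) (Fin n) ℝ) (b : Vec n) : Vec n → Vec n :=
  opMap (sqOp n) (-linOp A) (-b)

theorem rankOneMap_apply (A : Matrix (Fin n) (Fin n) ℝ) (b x : Vec n) (k : Fin n) :
    rankOneMap A b x k = x k ^ 2 - (∑ i, A k i * x i + b k) := by
  simp only [rankOneMap, opMap, PiLp.add_apply, _root_.neg_apply, PiLp.neg_apply,
    sqOp_apply, linOp_apply]
  ring

end EllipticQuadratic

end

/-! A functional in `posCone (sqOp n)` has nonnegative coefficients, and every coordinate functional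
is a limit of such functionals. So the intersection of ellipsoids is the set of subsolutions, `x_k²
≤ (Ax + b)_k` for all `k`. As `A ≥ 0`, coordinatewise maxima over this compact set form a
subsolution again; this greatest element `x*` solves the system.

With `σ` the sum of the column minima, the discriminant hypothesis says that the constant vector `v
= σ/2` is a strict subsolution. Expanding `P(v) < 0` at `x*` gives `P'(x*)(x* - v) > 0` with `x* - v
> 0`. Hence `P'(x)`, whose off-diagonal entries are nonpositive, is invertible with nonnegative
inverse for every `x ≥ x*` (a nonsingular M-matrix). Invertibility at `x*` yields stability.
Together with the convexity of each `P_k`, inverse positivity makes Newton's iteration decrease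
monotonically to `x*`. -/

namespace EllipticQuadratic

/-! ### Subsolutions of the system and their greatest element. -/

section SubsolutionSet

variable {ι : Type*} [Fintype ι]

/-- The set of all `x` with `x k ^ 2 ≤ ∑ i, A k i * x i + b k` for every `k`. -/
def subsolutionSet (A : Matrix ι ι ℝ) (b : ι → ℝ) : Set (ι → ℝ) :=
  {x | ∀ k, x k ^ 2 ≤ ∑ i, A k i * x i + b k}

/-- Minimum principle for M-matrices. If the least ratio `t = z j / w j` were negative, then `z ≥ t
w` would give `(Az)_j ≥ t (Aw)_j > t d_j w_j = d_j z_j`, a contradiction. -/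
theorem nonneg_of_mul_sub_nonneg {A : Matrix ι ι ℝ} (hA : ∀ i j, 0 ≤ A i j) {d w z : ι → ℝ}
    (hw : ∀ k, 0 < w k) (hdw : ∀ k, ∑ i, A k i * w i < d k * w k)
    (hdz : ∀ k, ∑ i, A k i * z i ≤ d k * z k) (k : ι) : 0 ≤ z k := by
  have : Nonempty ι := ⟨k⟩
  obtain ⟨j, hj⟩ := Finite.exists_min (fun i => z i / w i)
  set t := z j / w j with ht
  have hzj : z j = t * w j := by rw [ht, div_mul_cancel₀ _ (hw j).ne']
  have hle : ∀ i, t * w i ≤ z i := fun i => (le_div_iff₀ (hw i)).1 (hj i)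
  have ht0 : 0 ≤ t := by
    by_contra! hneg
    have h1 : t * ∑ i, A j i * w i ≤ ∑ i, A j i * z i := by
      rw [Finset.mul_sum]
      refine Finset.sum_le_sum fun i _ => ?_
      have := mul_le_mul_of_nonneg_left (hle i) (hA j i)
      linarith
    have h2 := hdz j
    have h3 := mul_lt_mul_of_neg_left (hdw j) hneg
    rw [hzj] at h2
    linarith
  exact (mul_nonneg ht0 (hw k).le).trans (hle k)

theorem isClosed_subsolutionSet (A : Matrix ι ι ℝ) (b : ι → ℝ) :
    IsClosed (subsolutionSet A b) := by
  simp only [subsolutionSet, Set.ofPred_forall]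
  exact isClosed_iInter fun k => isClosed_le (by fun_prop) (by fun_prop)

/-- The largest modulus `s = |x j|` satisfies `s² ≤ M s + β`, while `s² - M s - β` is positive at
`α` and increasing beyond it. -/
theorem abs_le_of_mem_subsolutionSet {A : Matrix ι ι ℝ} (hA : ∀ i j, 0 ≤ A i j) {b : ι → ℝ}
    {M β α : ℝ} (hM : ∀ i, ∑ j, A i j ≤ M) (hβ : ∀ i, b i ≤ β) (hMα : M < 2 * α)
    (hα : α * M + β < α ^ 2) {x : ι → ℝ} (hx : x ∈ subsolutionSet A b) (k : ι) : |x k| ≤ α := by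
  have : Nonempty ι := ⟨k⟩
  obtain ⟨j, hj⟩ := Finite.exists_max (fun i => |x i|)
  refine (hj k).trans ?_
  by_contra! hlt
  have h1 : ∑ i, A j i * x i ≤ M * |x j| :=
    calc ∑ i, A j i * x i ≤ ∑ i, A j i * |x j| :=
          Finset.sum_le_sum fun i _ =>
            mul_le_mul_of_nonneg_left ((le_abs_self _).trans (hj i)) (hA j i)
      _ = (∑ i, A j i) * |x j| := by rw [Finset.sum_mul]
      _ ≤ M * |x j| := mul_le_mul_of_nonneg_right (hM j) (abs_nonneg _)
  have h2 := hx j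
  rw [← sq_abs] at h2
  have h3 := hβ j
  nlinarith [mul_pos (sub_pos.2 hlt) (by linarith : 0 < |x j| + α - M)]

theorem exists_isGreatest_subsolutionSet {A : Matrix ι ι ℝ} (hA : ∀ i j, 0 ≤ A i j)
    {b : ι → ℝ} {R : ℝ} (hR : ∀ x ∈ subsolutionSet A b, ∀ k, |x k| ≤ R)
    (hne : (subsolutionSet A b).Nonempty) : ∃ x, IsGreatest (subsolutionSet A b) x := by
  have hcomp : IsCompact (subsolutionSet A b) :=
    (isCompact_Icc (a := fun _ : ι => -R) (b := fun _ => R)).of_isClosed_subset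
      (isClosed_subsolutionSet A b)
      fun x hx => ⟨fun k => (abs_le.1 (hR x hx k)).1, fun k => (abs_le.1 (hR x hx k)).2⟩
  have hmax : ∀ k, ∃ x ∈ subsolutionSet A b, ∀ y ∈ subsolutionSet A b, y k ≤ x k := fun k =>
    hcomp.exists_isMaxOn hne (continuous_apply k).continuousOn
  choose y hy hmaxy using hmax
  -- Row `k` holds for the maximiser `y k` of coordinate `k`; raising its other coordinates only
  -- increases the right-hand side.
  refine ⟨fun k => y k k, fun k => (hy k k).trans ?_, fun x hx k => hmaxy k x hx⟩
  gcongr with i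
  · exact hA k i
  · exact hmaxy i _ (hy k)

/-- The square roots of the right-hand sides form a subsolution above `x`, hence equal to `x`. -/
theorem IsGreatest.sq_eq {A : Matrix ι ι ℝ} (hA : ∀ i j, 0 ≤ A i j) {b x : ι → ℝ}
    (hx : IsGreatest (subsolutionSet A b) x) (k : ι) :
    x k ^ 2 = ∑ i, A k i * x i + b k := by
  let y : ι → ℝ := fun k => √(∑ i, A k i * x i + b k)
  have hysq : ∀ k, y k ^ 2 = ∑ i, A k i * x i + b k := fun k =>
    Real.sq_sqrt ((sq_nonneg _).trans (hx.1 k))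
  have hxy : ∀ k, x k ≤ y k := fun k => Real.le_sqrt_of_sq_le (hx.1 k)
  have hy : y ∈ subsolutionSet A b := by
    intro k
    rw [hysq]
    gcongr with i
    · exact hA k i
    · exact hxy i
  rw [← hysq, le_antisymm (hxy k) (hx.2 hy k)]

end SubsolutionSet

variable {n : ℕ}

/-! ### The ellipsoid intersection as a set of subsolutions. -/

theorem mem_ellipsoidInter_sqOp {A : Matrix (Fin n) (Fin n) ℝ} {b x : Vec n} :
    x ∈ ellipsoidInter (sqOp n) (-linOp A) (-b) ↔ x.ofLp ∈ subsolutionSet A b.ofLp := by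
  have hsum (f : Vec n →L[ℝ] ℝ) (y : Vec n) :
      f y = ∑ k, y k * f (EuclideanSpace.single k 1) := by
    conv_lhs => rw [← (EuclideanSpace.basisFun (Fin n) ℝ).sum_repr y]
    simp [map_sum]
  simp only [ellipsoidInter, Set.mem_iInter, ellipsoid, Set.mem_ofPred_eq]
  change (∀ f ∈ posCone (sqOp n), f (rankOneMap A b x) ≤ 0) ↔ _
  constructor
  · intro h k
    -- A coordinate functional need not be positive definite on `Q`; adding `ε` times the sum of all
    -- coordinates puts it in the cone, and then `ε → 0`.
    have hmem : ∀ ε : ℝ, 0 < ε →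
        (EuclideanSpace.proj k + ε • ∑ i, EuclideanSpace.proj i : Vec n →L[ℝ] ℝ) ∈
          posCone (sqOp n) := by
      intro ε hε
      refine ⟨ε, hε, fun y => ?_⟩
      simp only [add_apply, smul_apply, sum_apply,
        PiLp.proj_apply, sqOp_apply, EuclideanSpace.real_norm_sq_eq, smul_eq_mul]
      linarith [sq_nonneg (y k)]
    have hle : ∀ ε : ℝ, 0 < ε →
        rankOneMap A b x k + ε * ∑ i, rankOneMap A b x i ≤ 0 := by
      intro ε hε
      simpa using h _ (hmem ε hε)
    have hlim : Tendsto (fun ε : ℝ => rankOneMap A b x k + ε * ∑ i, rankOneMap A b x i)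
        (𝓝[>] 0) (𝓝 (rankOneMap A b x k + 0 * ∑ i, rankOneMap A b x i)) :=
      (Continuous.tendsto (by fun_prop) 0).mono_left nhdsWithin_le_nhds
    have := le_of_tendsto hlim (eventually_mem_nhdsWithin.mono fun ε hε => hle ε hε)
    rw [zero_mul, add_zero, rankOneMap_apply] at this
    linarith
  · rintro h f ⟨r, hr, hf⟩
    rw [hsum]
    refine Finset.sum_nonpos fun k _ => mul_nonpos_of_nonpos_of_nonneg ?_ ?_
    · rw [rankOneMap_apply]
      linarith [h k]
    · have h1 := hf (EuclideanSpace.single k 1)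
      -- `Q` fixes the basis vectors, so positivity of `f ∘ Q` makes the coefficients of `f`
      -- nonnegative.
      have h2 : sqOp n (EuclideanSpace.single k 1) = EuclideanSpace.single k 1 := by
        ext i
        rw [sqOp_apply]
        by_cases hik : i = k <;> simp [hik]
      rw [h2] at h1
      exact (mul_nonneg hr.le (sq_nonneg _)).trans h1

/-! ### The derivative of `P` and its inverse positivity. -/

/-- The derivative of `rankOneMap A b` at `x`. -/
noncomputable def rankOneDeriv (A : Matrix (Fin n) (Fin n) ℝ) (x : Vec n) : Vec n →L[ℝ] Vec n :=
  linOp (Matrix.diagonal (fun k => 2 * x k) - A)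

theorem rankOneDeriv_apply (A : Matrix (Fin n) (Fin n) ℝ) (x h : Vec n) (k : Fin n) :
    rankOneDeriv A x h k = 2 * x k * h k - ∑ i, A k i * h i := by
  rw [rankOneDeriv, linOp_apply]
  simp [sub_mul, Matrix.diagonal_apply, Finset.sum_sub_distrib]

theorem hasStrictFDerivAt_rankOneMap (A : Matrix (Fin n) (Fin n) ℝ) (b x : Vec n) :
    HasStrictFDerivAt (rankOneMap A b) (rankOneDeriv A x) x := by
  rw [hasStrictFDerivAt_euclidean]
  intro k
  have hp : ∀ i, HasStrictFDerivAt (fun y : Vec n => y i)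
      (EuclideanSpace.proj i : Vec n →L[ℝ] ℝ) x := fun i =>
    (EuclideanSpace.proj i : Vec n →L[ℝ] ℝ).hasStrictFDerivAt
  have h := ((hp k).pow 2).sub
    ((HasStrictFDerivAt.fun_sum (u := Finset.univ) fun i _ => (hp i).const_mul (A k i)).add_const
      (b k))
  refine (h.congr_fderiv ?_).congr_of_eventuallyEq (.of_forall fun y => ?_)
  · ext h
    simp [rankOneDeriv_apply]
  · exact (rankOneMap_apply A b y k).symm

theorem fderiv_rankOneMap (A : Matrix (Fin n) (Fin n) ℝ) (b x : Vec n) :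
    fderiv ℝ (rankOneMap A b) x = rankOneDeriv A x :=
  (hasStrictFDerivAt_rankOneMap A b x).hasFDerivAt.fderiv

theorem rankOneMap_sub (A : Matrix (Fin n) (Fin n) ℝ) (b x y : Vec n) (k : Fin n) :
    rankOneMap A b y k =
      rankOneMap A b x k + rankOneDeriv A x (y - x) k + (y k - x k) ^ 2 := by
  simp only [rankOneMap_apply, rankOneDeriv_apply, PiLp.sub_apply, mul_sub,
    Finset.sum_sub_distrib]
  ring

theorem nonneg_of_rankOneDeriv_nonneg {A : Matrix (Fin n) (Fin n) ℝ} (hA : ∀ i j, 0 ≤ A i j)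
    {x w z : Vec n} (hw : ∀ k, 0 < w k) (hxw : ∀ k, 0 < rankOneDeriv A x w k)
    (hz : ∀ k, 0 ≤ rankOneDeriv A x z k) (k : Fin n) : 0 ≤ z k := by
  simp only [rankOneDeriv_apply, sub_pos, sub_nonneg] at hxw hz
  exact nonneg_of_mul_sub_nonneg hA hw hxw hz k

/-- The minimum principle applied to `z` and `-z` shows that the kernel is trivial. -/
theorem isInvertible_rankOneDeriv {A : Matrix (Fin n) (Fin n) ℝ} (hA : ∀ i j, 0 ≤ A i j)
    {x w : Vec n} (hw : ∀ k, 0 < w k) (hxw : ∀ k, 0 < rankOneDeriv A x w k) :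
    (rankOneDeriv A x).IsInvertible := by
  have hinj : Function.Injective (rankOneDeriv A x : Vec n →ₗ[ℝ] Vec n) := by
    rw [← LinearMap.ker_eq_bot, LinearMap.ker_eq_bot']
    intro z hz
    replace hz : rankOneDeriv A x z = 0 := hz
    ext k
    have h1 := nonneg_of_rankOneDeriv_nonneg hA hw hxw (z := z) (by simp [hz]) k
    have h2 := nonneg_of_rankOneDeriv_nonneg hA hw hxw (z := -z) (by simp [hz]) k
    rw [PiLp.neg_apply] at h2
    rw [PiLp.zero_apply]
    linarith
  exact ⟨(LinearEquiv.ofInjectiveEndo _ hinj).toContinuousLinearEquiv, by ext; rfl⟩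

/-- Increasing `x` only increases the diagonal, so one positive vector `w` serves at all points
above `x`. -/
theorem rankOneDeriv_pos_of_le {A : Matrix (Fin n) (Fin n) ℝ} {x y w : Vec n}
    (hw : ∀ k, 0 < w k) (hxw : ∀ k, 0 < rankOneDeriv A x w k) (hxy : ∀ k, x k ≤ y k)
    (k : Fin n) : 0 < rankOneDeriv A y w k := by
  have h := hxw k
  rw [rankOneDeriv_apply] at h ⊢
  nlinarith [mul_nonneg (sub_nonneg.2 (hxy k)) (hw k).le]

/-! ### Norm estimates for quadratic operators, and stability. -/

theorem continuous_quadOp (Q : QuadOp n) : Continuous Q := by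
  let B : Vec n →L[ℝ] Vec n →L[ℝ] Vec n := LinearMap.toContinuousLinearMap
    ((LinearMap.toContinuousLinearMap : (Vec n →ₗ[ℝ] Vec n) ≃ₗ[ℝ] _).toLinearMap ∘ₗ
      QuadraticMap.associated Q)
  have hB : ∀ x, Q x = B x x := fun x => (QuadraticMap.associated_eq_self_apply ℝ Q x).symm
  rw [funext hB]
  fun_prop

theorem norm_quadOp_le (Q : QuadOp n) (x : Vec n) : ‖Q x‖ ≤ quadNorm Q * ‖x‖ ^ 2 := by
  have hbdd : BddAbove ((fun x : Vec n => ‖Q x‖) '' Metric.closedBall 0 1) :=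
    ((isCompact_closedBall 0 1).image (continuous_quadOp Q).norm).bddAbove
  rcases eq_or_ne x 0 with rfl | hx
  · simp
  have hx' : 0 < ‖x‖ := norm_pos_iff.2 hx
  have h : ‖Q (‖x‖⁻¹ • x)‖ ≤ quadNorm Q :=
    le_csSup hbdd ⟨_, by simp [norm_smul, hx'.ne'], rfl⟩
  rw [QuadraticMap.map_smul, norm_smul, Real.norm_of_nonneg (by positivity)] at h
  calc ‖Q x‖ = ‖x‖⁻¹ * ‖x‖⁻¹ * ‖Q x‖ * ‖x‖ ^ 2 := by field_simp
    _ ≤ quadNorm Q * ‖x‖ ^ 2 := by gcongr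

theorem quadNorm_nonneg (Q : QuadOp n) : 0 ≤ quadNorm Q :=
  Real.sSup_nonneg (by rintro _ ⟨x, -, rfl⟩; exact norm_nonneg _)

theorem norm_polar_le (Q : QuadOp n) (x y : Vec n) :
    ‖QuadraticMap.polar Q x y‖ ≤ 4 * quadNorm Q * ‖x‖ * ‖y‖ := by
  have hunit : ∀ u v : Vec n, ‖u‖ = 1 → ‖v‖ = 1 → ‖QuadraticMap.polar Q u v‖ ≤ 4 * quadNorm Q := by
    intro u v hu hv
    -- With the parallelogram law this bounds the polar form by `2 * quadNorm Q` on unit vectors;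
    -- the constant 4 is not sharp.
    have hpar : (2 : ℝ) • QuadraticMap.polar Q u v = Q (u + v) - Q (u - v) := by
      have h1 : Q (u + v) = Q u + Q v + QuadraticMap.polar Q u v := QuadraticMap.map_add Q u v
      have h2 : Q (u - v) = Q u + Q v - QuadraticMap.polar Q u v := by
        rw [sub_eq_add_neg, QuadraticMap.map_add Q u (-v), QuadraticMap.map_neg,
          QuadraticMap.polar_neg_right]
        abel
      rw [h1, h2, two_smul]
      abel
    have h1 := norm_quadOp_le Q (u + v)
    have h2 := norm_quadOp_le Q (u - v)
    have h3 : ‖Q (u + v) - Q (u - v)‖ ≤ _ := norm_sub_le _ _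
    rw [← hpar, norm_smul, Real.norm_two] at h3
    have h4 := parallelogram_law_with_norm ℝ u v
    rw [hu, hv] at h4
    have h5 : quadNorm Q * ‖u + v‖ ^ 2 + quadNorm Q * ‖u - v‖ ^ 2 = quadNorm Q * 4 := by
      rw [← mul_add]; congr 1; linarith
    linarith [quadNorm_nonneg Q]
  rcases eq_or_ne x 0 with rfl | hx
  · simp
  rcases eq_or_ne y 0 with rfl | hy
  · simp
  have hx' : 0 < ‖x‖ := norm_pos_iff.2 hx
  have hy' : 0 < ‖y‖ := norm_pos_iff.2 hy
  have h := hunit (‖x‖⁻¹ • x) (‖y‖⁻¹ • y) (by simp [norm_smul, hx'.ne'])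
    (by simp [norm_smul, hy'.ne'])
  rw [QuadraticMap.polar_smul_left, QuadraticMap.polar_smul_right, norm_smul, norm_smul,
    norm_inv, norm_inv, norm_norm, norm_norm] at h
  calc ‖QuadraticMap.polar Q x y‖
      = ‖x‖⁻¹ * (‖y‖⁻¹ * ‖QuadraticMap.polar Q x y‖) * ‖x‖ * ‖y‖ := by field_simp
    _ ≤ 4 * quadNorm Q * ‖x‖ * ‖y‖ := by gcongr

theorem norm_quadOp_sub_le (Q : QuadOp n) {R : ℝ} {x y : Vec n} (hx : ‖x‖ ≤ R) (hy : ‖y‖ ≤ R) :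
    ‖Q x - Q y‖ ≤ 6 * R * quadNorm Q * ‖x - y‖ := by
  have h1 : Q x - Q y = Q (x - y) + QuadraticMap.polar Q (x - y) y := by
    have := QuadraticMap.map_add Q (x - y) y
    rw [sub_add_cancel] at this
    rw [this]
    abel
  have h2 := norm_quadOp_le Q (x - y)
  have h3 := norm_polar_le Q (x - y) y
  have h4 : ‖x - y‖ ≤ 2 * R := (norm_sub_le _ _).trans (by linarith)
  have hq := quadNorm_nonneg Q
  have h5 : quadNorm Q * ‖x - y‖ ^ 2 ≤ quadNorm Q * (2 * R * ‖x - y‖) := by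
    rw [sq]; gcongr
  have h6 : 4 * quadNorm Q * ‖x - y‖ * ‖y‖ ≤ 4 * quadNorm Q * ‖x - y‖ * R := by gcongr
  rw [h1]
  refine (norm_add_le _ _).trans ?_
  linarith

/-- Near `x₀` the perturbed map is still close to the invertible `P'` in the Lipschitz sense, so it
maps a small ball onto a ball around its value at `x₀`. For small perturbations that image ball
contains 0. -/
theorem isStableSolution_of_isInvertible {Q : QuadOp n} {L : Vec n →L[ℝ] Vec n} {c x₀ : Vec n}
    {P' : Vec n →L[ℝ] Vec n} (hx₀ : opMap Q L c x₀ = 0)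
    (hP : HasStrictFDerivAt (opMap Q L c) P' x₀) (hinv : P'.IsInvertible) :
    IsStableSolution Q L c x₀ := by
  refine ⟨hx₀, fun ε hε => ?_⟩
  obtain ⟨e, rfl⟩ := hinv
  rcases e.subsingleton_or_nnnorm_symm_pos with hsub | hN
  · exact ⟨1, one_pos, fun Q' L' c' _ _ _ => ⟨x₀, Subsingleton.elim _ _, by simpa⟩⟩
  set N : NNReal := ‖(e.symm : Vec n →L[ℝ] Vec n)‖₊ with hNdef
  -- Of `N⁻¹ = 3κ`, one `κ` pays for the nonlinearity of `P`, one for the perturbation, and the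
  -- third leaves an image ball of radius `κ * r`.
  obtain ⟨κ, hκ⟩ : ∃ κ : NNReal, κ = N⁻¹ / 3 := ⟨_, rfl⟩
  have hκ0 : 0 < κ := by rw [hκ]; positivity
  have hκ0' : (0 : ℝ) < κ := hκ0
  have hκ' : (N : ℝ)⁻¹ = 3 * κ := by rw [hκ]; push_cast; ring
  obtain ⟨s, hs, hPs⟩ := hP.approximates_deriv_on_nhds (Or.inr hκ0)
  obtain ⟨r₁, hr₁, hr₁s⟩ := Metric.nhds_basis_closedBall.mem_iff.1 hs
  obtain ⟨r, hr⟩ : ∃ r, r = min r₁ (ε / 2) := ⟨_, rfl⟩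
  have hr0 : 0 < r := hr ▸ lt_min hr₁ (half_pos hε)
  have hrε : r < ε := (hr ▸ min_le_right _ _ : r ≤ ε / 2).trans_lt (half_lt_self hε)
  have hrs : Metric.closedBall x₀ r ⊆ s :=
    (Metric.closedBall_subset_closedBall (hr ▸ min_le_left _ _)).trans hr₁s
  obtain ⟨R, hR⟩ : ∃ R, R = ‖x₀‖ + r := ⟨_, rfl⟩
  have hR0 : 0 < R := hR ▸ add_pos_of_nonneg_of_pos (norm_nonneg _) hr0
  have hx₀R : ‖x₀‖ ≤ R := by linarith
  have hballR : ∀ x ∈ Metric.closedBall x₀ r, ‖x‖ ≤ R := fun x hx => by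
    have h1 := norm_le_norm_add_norm_sub' x x₀
    rw [mem_closedBall_iff_norm] at hx
    linarith
  -- The first bound keeps the Lipschitz constant of the perturbation below `κ`; the second keeps
  -- its value at `x₀` within `κ * r`.
  refine ⟨min (κ / (6 * R + 1)) (κ * r / (R ^ 2 + R + 1)), by positivity,
    fun Q' L' c' hQ hL hc => ?_⟩
  obtain ⟨δ, hδ⟩ : ∃ δ, δ = min (κ / (6 * R + 1)) (κ * r / (R ^ 2 + R + 1)) := ⟨_, rfl⟩
  rw [← hδ] at hQ hL hc
  have hδ1 : (6 * R + 1) * δ ≤ κ := by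
    have : δ ≤ κ / (6 * R + 1) := hδ ▸ min_le_left _ _
    rw [le_div_iff₀ (by positivity)] at this
    linarith
  have hδ2 : (R ^ 2 + R + 1) * δ ≤ κ * r := by
    have : δ ≤ κ * r / (R ^ 2 + R + 1) := hδ ▸ min_le_right _ _
    rw [le_div_iff₀ (by positivity)] at this
    linarith
  have hδ0 : 0 ≤ δ := (norm_nonneg _).trans hc.le
  have hdiff : ∀ x, opMap Q' L' c' x =
      opMap Q L c x + ((Q' - Q) x + (L' - L) x + (c' - c)) := fun x => by
    simp only [opMap, sub_apply]
    abel
  have happrox : ApproximatesLinearOn (opMap Q' L' c') (e : Vec n →L[ℝ] Vec n)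
      (Metric.closedBall x₀ r) (κ + κ) := by
    intro x hx y hy
    have h1 := hPs x (hrs hx) y (hrs hy)
    have h2 := norm_quadOp_sub_le (Q' - Q) (hballR x hx) (hballR y hy)
    have h3 := (L' - L).le_opNorm (x - y)
    have h4 : opMap Q' L' c' x - opMap Q' L' c' y - (e : Vec n →L[ℝ] Vec n) (x - y) =
        (opMap Q L c x - opMap Q L c y - (e : Vec n →L[ℝ] Vec n) (x - y)) +
          ((Q' - Q) x - (Q' - Q) y) + (L' - L) (x - y) := by
      rw [hdiff, hdiff, map_sub (L' - L)]
      abel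
    have h5 : 6 * R * quadNorm (Q' - Q) * ‖x - y‖ + ‖L' - L‖ * ‖x - y‖ ≤ κ * ‖x - y‖ := by
      rw [← add_mul]
      refine mul_le_mul_of_nonneg_right ?_ (norm_nonneg _)
      have := mul_le_mul_of_nonneg_left hQ.le (by positivity : 0 ≤ 6 * R)
      linarith
    rw [h4, NNReal.coe_add]
    refine norm_add₃_le.trans ?_
    linarith
  have hval : ‖opMap Q' L' c' x₀‖ ≤ κ * r := by
    rw [hdiff, hx₀, zero_add]
    have h1 : ‖(Q' - Q) x₀‖ ≤ δ * R ^ 2 := (norm_quadOp_le _ _).trans (by gcongr)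
    have h2 : ‖(L' - L) x₀‖ ≤ δ * R := ((L' - L).le_opNorm _).trans (by gcongr)
    refine norm_add₃_le.trans ?_
    linarith
  obtain ⟨x, hx, hx0⟩ := happrox.surjOn_closedBall_of_nonlinearRightInverse
    e.toNonlinearRightInverse hr0.le subset_rfl (show (0 : Vec n) ∈ _ by
      rw [mem_closedBall_iff_norm, zero_sub, norm_neg]
      refine hval.trans_eq ?_
      change _ = ((N : ℝ)⁻¹ - (κ + κ : NNReal)) * r
      rw [hκ', NNReal.coe_add]
      ring)
  exact ⟨x, hx0, (mem_closedBall_iff_norm.1 hx).trans_lt hrε⟩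

/-! ### Monotone convergence of Newton's iteration. -/

/-- By convexity the linearisation of `P` at `x` is at most `P(xs) = 0` at `xs`, and it vanishes at
the new point; inverse positivity turns this into an order relation. At the new point only the
square remainder of `P` is left, which is nonnegative. -/
theorem newton_step {A : Matrix (Fin n) (Fin n) ℝ} (hA : ∀ i j, 0 ≤ A i j) {b xs w x : Vec n}
    (hxs : rankOneMap A b xs = 0) (hw : ∀ k, 0 < w k)
    (hxw : ∀ k, 0 < rankOneDeriv A xs w k) (hx : ∀ k, xs k ≤ x k)
    (hPx : ∀ k, 0 ≤ rankOneMap A b x k) :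
    (∀ k, xs k ≤ (x - (fderiv ℝ (rankOneMap A b) x).inverse (rankOneMap A b x)) k) ∧
    (∀ k, (x - (fderiv ℝ (rankOneMap A b) x).inverse (rankOneMap A b x)) k ≤ x k) ∧
    (∀ k, 0 ≤ rankOneMap A b
      (x - (fderiv ℝ (rankOneMap A b) x).inverse (rankOneMap A b x)) k) := by
  have hpos := rankOneDeriv_pos_of_le hw hxw hx
  rw [fderiv_rankOneMap]
  set h := (rankOneDeriv A x).inverse (rankOneMap A b x) with hh
  have hDh : rankOneDeriv A x h = rankOneMap A b x :=
    (isInvertible_rankOneDeriv hA hw hpos).self_apply_inverse _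
  refine ⟨fun k => ?_, fun k => ?_, fun k => ?_⟩
  · have := nonneg_of_rankOneDeriv_nonneg hA hw hpos (z := x - h - xs) (fun k => ?_) k
    · simp only [PiLp.sub_apply] at this ⊢
      linarith
    · have h1 := rankOneMap_sub A b x xs k
      have h2 : rankOneDeriv A x (x - h - xs) = -rankOneDeriv A x (xs - x) - rankOneMap A b x := by
        rw [← hDh, ← map_neg, ← map_sub]
        congr 1
        abel
      rw [hxs, PiLp.zero_apply] at h1
      rw [h2, PiLp.sub_apply, PiLp.neg_apply]
      nlinarith [sq_nonneg (xs k - x k)]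
  · have := nonneg_of_rankOneDeriv_nonneg hA hw hpos (z := h) (by rwa [hDh]) k
    rw [PiLp.sub_apply]
    linarith
  · rw [rankOneMap_sub A b x (x - h) k, sub_sub_cancel_left, map_neg, hDh, PiLp.neg_apply]
    nlinarith [sq_nonneg ((x - h) k - x k)]

theorem newtonIter_rankOneMap {A : Matrix (Fin n) (Fin n) ℝ} (hA : ∀ i j, 0 ≤ A i j)
    {b xs w x : Vec n} (hxs : rankOneMap A b xs = 0) (hw : ∀ k, 0 < w k)
    (hxw : ∀ k, 0 < rankOneDeriv A xs w k) (hx : ∀ k, xs k ≤ x k)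
    (hPx : ∀ k, 0 ≤ rankOneMap A b x k) (m : ℕ) :
    (∀ k, xs k ≤ newtonIter (rankOneMap A b) x m k) ∧
      ∀ k, 0 ≤ rankOneMap A b (newtonIter (rankOneMap A b) x m) k := by
  induction m with
  | zero => exact ⟨hx, hPx⟩
  | succ m ih =>
    obtain ⟨h1, -, h3⟩ := newton_step hA hxs hw hxw ih.1 ih.2
    exact ⟨h1, h3⟩

theorem isInvertible_fderiv_newtonIter {A : Matrix (Fin n) (Fin n) ℝ} (hA : ∀ i j, 0 ≤ A i j)
    {b xs w x : Vec n} (hxs : rankOneMap A b xs = 0) (hw : ∀ k, 0 < w k)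
    (hxw : ∀ k, 0 < rankOneDeriv A xs w k) (hx : ∀ k, xs k ≤ x k)
    (hPx : ∀ k, 0 ≤ rankOneMap A b x k) (m : ℕ) :
    (fderiv ℝ (rankOneMap A b) (newtonIter (rankOneMap A b) x m)).IsInvertible := by
  rw [fderiv_rankOneMap]
  exact isInvertible_rankOneDeriv hA hw
    (rankOneDeriv_pos_of_le hw hxw (newtonIter_rankOneMap hA hxs hw hxw hx hPx m).1)

/-- The iterates decrease and stay above `xs`, so they converge. Passing to the limit in
`P'(u_m)(u_{m+1} - u_m) = -P(u_m)`, which needs no bound on the inverses, shows that the limit is a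
zero of `P`; by `hmax` it lies below `xs`. -/
theorem tendsto_newtonIter {A : Matrix (Fin n) (Fin n) ℝ} (hA : ∀ i j, 0 ≤ A i j)
    {b xs w x : Vec n} (hxs : rankOneMap A b xs = 0)
    (hmax : ∀ y : Vec n, rankOneMap A b y = 0 → ∀ k, y k ≤ xs k) (hw : ∀ k, 0 < w k)
    (hxw : ∀ k, 0 < rankOneDeriv A xs w k) (hx : ∀ k, xs k ≤ x k)
    (hPx : ∀ k, 0 ≤ rankOneMap A b x k) :
    Tendsto (newtonIter (rankOneMap A b) x) atTop (𝓝 xs) := by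
  set u := newtonIter (rankOneMap A b) x with hu
  have hinv := newtonIter_rankOneMap hA hxs hw hxw hx hPx
  have hanti : ∀ k, Antitone fun m => u m k := fun k =>
    antitone_nat_of_succ_le fun m => (newton_step hA hxs hw hxw (hinv m).1 (hinv m).2).2.1 k
  have hlim : ∀ k, ∃ l, Tendsto (fun m => u m k) atTop (𝓝 l) := fun k =>
    ⟨_, tendsto_atTop_ciInf (hanti k) ⟨xs k, by rintro _ ⟨m, rfl⟩; exact (hinv m).1 k⟩⟩
  choose l hl using hlim
  have hul : ∀ k, Tendsto (fun m => u (m + 1) k) atTop (𝓝 (l k)) := fun k =>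
    (tendsto_add_atTop_iff_nat 1).2 (hl k)
  have hrec : ∀ m, rankOneDeriv A (u m) (u (m + 1) - u m) = -rankOneMap A b (u m) := by
    intro m
    have h1 : u (m + 1) - u m =
        -(fderiv ℝ (rankOneMap A b) (u m)).inverse (rankOneMap A b (u m)) := by
      rw [hu, newtonIter]
      abel
    rw [h1, map_neg, ← fderiv_rankOneMap A b,
      (isInvertible_fderiv_newtonIter hA hxs hw hxw hx hPx m).self_apply_inverse]
  have hzero : rankOneMap A b (WithLp.toLp 2 l) = 0 := by
    ext k
    have h1 : Tendsto (fun m => rankOneDeriv A (u m) (u (m + 1) - u m) k) atTop (𝓝 0) := by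
      simp only [rankOneDeriv_apply, PiLp.sub_apply]
      have := (((hl k).const_mul 2).mul ((hul k).sub (hl k))).sub
        (tendsto_finsetSum Finset.univ fun i _ => ((hul i).sub (hl i)).const_mul (A k i))
      simpa using this
    have h2 : Tendsto (fun m => rankOneDeriv A (u m) (u (m + 1) - u m) k) atTop
        (𝓝 (-rankOneMap A b (WithLp.toLp 2 l) k)) := by
      simp only [hrec, PiLp.neg_apply, rankOneMap_apply]
      exact (((hl k).pow 2).sub ((tendsto_finsetSum Finset.univ
        fun i _ => (hl i).const_mul (A k i)).add_const (b k))).neg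
    have := tendsto_nhds_unique h1 h2
    rw [PiLp.zero_apply]
    linarith
  have hlx : l = xs.ofLp := funext fun k =>
    le_antisymm (hmax _ hzero k) (ge_of_tendsto' (hl k) fun m => (hinv m).1 k)
  have h := ((PiLp.continuous_toLp 2 (fun _ : Fin n => ℝ)).tendsto l).comp (tendsto_pi_nhds.2 hl)
  rw [hlx] at h
  exact h

end EllipticQuadratic

/-! ### Assembly of the theorem. -/

theorem theorem7p4 (n : ℕ) (hn : 1 ≤ n)
    (A : Matrix (Fin n) (Fin n) ℝ) (b : EuclideanSpace ℝ (Fin n))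
    (hA : ∀ i j, 0 ≤ A i j)
    (hcond : 0 < (∑ j, ⨅ i, |A i j|) ^ 2 + 4 * ⨅ i, b i)
    (M : ℝ) (hM : M = ⨆ i, ∑ j, A i j)
    (β : ℝ) (hβ : β = ⨆ i, b i)
    (α : ℝ) (hα : (M + Real.sqrt (M ^ 2 + 4 * β)) / 2 < α) :
    ∃ xs : EuclideanSpace ℝ (Fin n),
      (∀ i, IsGreatest ((fun x : EuclideanSpace ℝ (Fin n) => x i) ''
        EllipticQuadratic.ellipsoidInter (EllipticQuadratic.sqOp n)
          (-EllipticQuadratic.linOp A) (-b)) (xs i)) ∧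
      (∀ k, xs k ^ 2 = ∑ i, A k i * xs i + b k) ∧
      EllipticQuadratic.IsStableSolution (EllipticQuadratic.sqOp n)
        (-EllipticQuadratic.linOp A) (-b) xs ∧
      (∀ m, (fderiv ℝ (EllipticQuadratic.rankOneMap A b)
        (EllipticQuadratic.newtonIter (EllipticQuadratic.rankOneMap A b)
          (WithLp.toLp 2 fun _ => α) m)).IsInvertible) ∧
      Tendsto (EllipticQuadratic.newtonIter (EllipticQuadratic.rankOneMap A b)
        (WithLp.toLp 2 fun _ => α)) atTop (𝓝 xs) := by
  have : Nonempty (Fin n) := ⟨⟨0, hn⟩⟩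
  have hrow : ∀ i, ∑ j, A i j ≤ M := fun i => hM ▸
    le_ciSup (f := fun i => ∑ j, A i j) (Set.finite_range _).bddAbove i
  have hbβ : ∀ i, b i ≤ β := fun i => hβ ▸ le_ciSup (Set.finite_range _).bddAbove i
  obtain ⟨μ, hμ⟩ : ∃ μ, μ = ⨅ i, b i := ⟨_, rfl⟩
  obtain ⟨σ, hσ⟩ : ∃ σ, σ = ∑ j, ⨅ i, |A i j| := ⟨_, rfl⟩
  rw [← hμ, ← hσ] at hcond
  have hμb : ∀ i, μ ≤ b i := fun i => hμ ▸ ciInf_le (Set.finite_range _).bddBelow i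
  have hσrow : ∀ i, σ ≤ ∑ j, A i j := fun i => by
    rw [hσ]
    refine Finset.sum_le_sum fun j _ => ?_
    exact (ciInf_le (Set.finite_range _).bddBelow i).trans_eq (abs_of_nonneg (hA i j))
  have hσ0 : 0 ≤ σ := hσ ▸ Finset.sum_nonneg fun j _ => Real.iInf_nonneg fun i => abs_nonneg _
  obtain ⟨i₀⟩ := this
  have hσM : σ ≤ M := (hσrow i₀).trans (hrow i₀)
  have hdisc : 0 < M ^ 2 + 4 * β := by
    have := (hμb i₀).trans (hbβ i₀)
    nlinarith
  have hsqrt := Real.sqrt_pos.2 hdisc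
  have hMα : M < 2 * α := by linarith
  have hα0 : 0 < α := by linarith
  have hαβ : α * M + β < α ^ 2 := by
    have h1 : √(M ^ 2 + 4 * β) < 2 * α - M := by linarith
    have h2 := Real.lt_sq_of_sqrt_lt h1
    nlinarith
  have hbound := fun x (hx : x ∈ EllipticQuadratic.subsolutionSet A b.ofLp) =>
    EllipticQuadratic.abs_le_of_mem_subsolutionSet hA hrow hbβ hMα hαβ hx
  -- Each row sum is at least `σ` and `b k ≥ μ`, so this follows from `σ² / 4 < σ² / 2 + μ`, which
  -- is `hcond`.
  have hconst : ∀ k, (σ / 2) ^ 2 < ∑ i, A k i * (σ / 2) + b k := fun k => by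
    rw [← Finset.sum_mul]
    nlinarith [hμb k, mul_le_mul_of_nonneg_right (hσrow k) hσ0]
  have hconst_mem : (fun _ => σ / 2) ∈ EllipticQuadratic.subsolutionSet A b.ofLp :=
    fun k => (hconst k).le
  obtain ⟨y, hy⟩ := EllipticQuadratic.exists_isGreatest_subsolutionSet hA hbound ⟨_, hconst_mem⟩
  have hσy : ∀ k, σ / 2 ≤ y k := fun k => hy.2 hconst_mem k
  have hsol := EllipticQuadratic.IsGreatest.sq_eq hA hy
  obtain ⟨xs, rfl⟩ : ∃ xs : EuclideanSpace ℝ (Fin n), y = xs.ofLp := ⟨WithLp.toLp 2 y, rfl⟩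
  have hzero : EllipticQuadratic.rankOneMap A b xs = 0 := by
    ext k
    rw [EllipticQuadratic.rankOneMap_apply, hsol k, sub_self, PiLp.zero_apply]
  obtain ⟨v, hv⟩ : ∃ v : EuclideanSpace ℝ (Fin n), v = WithLp.toLp 2 fun _ => σ / 2 := ⟨_, rfl⟩
  -- The exact expansion at `xs` gives `P'(xs)(xs - v) = -P(v) + (v - xs)²` coordinatewise, and
  -- `P(v) < 0`.
  have hDw : ∀ k, 0 < EllipticQuadratic.rankOneDeriv A xs (xs - v) k := fun k => by
    have h1 := EllipticQuadratic.rankOneMap_sub A b xs v k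
    have h2 := hconst k
    rw [hzero, EllipticQuadratic.rankOneMap_apply, ← neg_sub xs v, map_neg, PiLp.zero_apply,
      PiLp.neg_apply] at h1
    simp only [hv] at h1 ⊢
    nlinarith [sq_nonneg (σ / 2 - xs k)]
  have hw0 : ∀ k, 0 ≤ (xs - v) k := fun k => by
    simpa [hv] using hσy k
  -- If coordinate `k` vanished, row `k` of `P'(xs)(xs - v)` would keep only nonpositive
  -- off-diagonal terms, against `hDw`.
  have hw : ∀ k, 0 < (xs - v) k := fun k => by
    have h1 := hDw k
    rw [EllipticQuadratic.rankOneDeriv_apply] at h1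
    have h2 : 0 ≤ ∑ i, A k i * (xs - v) i :=
      Finset.sum_nonneg fun i _ => mul_nonneg (hA k i) (hw0 i)
    refine (hw0 k).lt_of_ne fun h0 => ?_
    rw [← h0, mul_zero] at h1
    linarith
  have hxα : ∀ k, xs k ≤ (WithLp.toLp 2 fun _ => α : EuclideanSpace ℝ (Fin n)) k := fun k =>
    (le_abs_self _).trans (hbound _ hy.1 k)
  have hPα : ∀ k, 0 ≤ EllipticQuadratic.rankOneMap A b (WithLp.toLp 2 fun _ => α) k := fun k => by
    rw [EllipticQuadratic.rankOneMap_apply]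
    simp only
    rw [← Finset.sum_mul]
    nlinarith [hbβ k, mul_le_mul_of_nonneg_right (hrow k) hα0.le]
  refine ⟨xs, fun i => ⟨⟨xs, EllipticQuadratic.mem_ellipsoidInter_sqOp.2 hy.1, rfl⟩, ?_⟩, hsol,
    EllipticQuadratic.isStableSolution_of_isInvertible hzero
      (EllipticQuadratic.hasStrictFDerivAt_rankOneMap A b xs)
      (EllipticQuadratic.isInvertible_rankOneDeriv hA hw hDw),
    EllipticQuadratic.isInvertible_fderiv_newtonIter hA hzero hw hDw hxα hPα,
    EllipticQuadratic.tendsto_newtonIter hA hzero (fun z hz k => ?_) hw hDw hxα hPα⟩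
  · rintro _ ⟨z, hz, rfl⟩
    exact hy.2 (EllipticQuadratic.mem_ellipsoidInter_sqOp.1 hz) i
  · refine hy.2 (show z.ofLp ∈ EllipticQuadratic.subsolutionSet A b.ofLp from fun k => ?_) k
    have := congrArg (fun v : EuclideanSpace ℝ (Fin n) => v k) hz
    simp only [EllipticQuadratic.rankOneMap_apply, PiLp.zero_apply] at this
    linarith
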